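/- For $b>0$ consider the quadratic communication game with bias $b$: the state, signal and action spaces are $\Omega=\mathcal S=\mathcal A=[0,1]$, the prior $p$ is the uniform distribution on $[0,1]$, the sender's utility is $u(a,\omega)=-(a-\omega-b)^2$ and the receiver's utility is $v(a,\omega)=-(a-\omega)^2$. An information structure is a Markov kernel $\pi(ds\mid\omega)$, a receiver strategy is a Markov kernel $\alpha(da\mid s)$, a belief system is a Markov kernel $\lambda(d\omega\mid s)$; the sender's payoff is $\int\!\int\!\int u(a,\omega)\,\alpha(da\mid s)\,\pi(ds\mid\omega)\,p(d\omega)$. A belief system is Bayes-consistent with $\pi$ if it is a regular conditional distribution of the state given the signal under $p(d\omega)\pi(ds\mid\omega)$. In covert signaling, a perfect Bayesian equilibrium (PBE) is a triple $(\pi,\alpha,\lambda)$ such that $\pi$ maximizes the sender's payoff given $\alpha$, for every signal $s$ the mixed action $\alpha(\cdot\mid s)$ maximizes the receiver's expected utility under $\lambda(\cdot\mid s)$, and $\lambda$ is Bayes-consistent with $\pi$; $U^{CS}(b)$ denotes the supremum of the sender's PBE payoffs. In overt persuasion, $U^{OP}(b)$ is the supremum of the sender's payoff over all triples $(\pi,\alpha,\lambda)$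 in which $\lambda$ is Bayes-consistent with $\pi$ and $\alpha(\cdot\mid s)$ is optimal for the receiver under $\lambda(\cdot\mid s)$ for every $s$ (no optimality of $\pi$ given $\alpha$ being required). Since all payoffs are non-positive, the price of transparency at a PBE payoff $x$ is the ratio of losses $\mathrm{PoT}(b,x)=U^{OP}(b)/x$, and $\mathrm{PoT}(b)=\mathrm{PoT}(b,U^{CS}(b))$. Then: 1. For every $b>0$, the value $U^{OP}(b)$ is attained and $U^{OP}(b)=-b^2$. 2. For every $b>0$, the value $U^{CS}(b)$ is attained, and it is attained by a PBE in partition form with $N(b)=\lceil -\tfrac12+\tfrac12\sqrt{1+2/b}\,\rceil$ cells: there are $0=k_0<k_1<\dots<k_{N(b)}=1$ such that $\pi(\cdot\mid\omega)$ is the uniform distribution on $(k_i,k_{i+1})$ whenever $\omega\in(k_i,k_{i+1})$. 3. $U^{CS}(b)=\Theta(b)$ as $b\to0^+$. 4. $\mathrm{PoT}(b)\to 0$ as $b\to 0^+$; moreover the convergence is uniform over all equilibria: for every $\varepsilon>0$ there is $\delta>0$ such that for all $0<b<\delta$ every PBE payoff $x$ is negative and $0<\mathrm{PoT}(b,x)<\varepsilon$.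 -/

import Mathlib

open MeasureTheory ProbabilityTheory Filter Topology Asymptotics unitInterval

noncomputable section

namespace QCG

/-- Sender's utility `u(a, ω) = -(a - ω - b)²` (action `a`, state `ω`, bias `b`). -/
def senderUtility (b : ℝ) (a ω : I) : ℝ := -((a : ℝ) - (ω : ℝ) - b) ^ 2

/-- Receiver's utility `v(a, ω) = -(a - ω)²`. -/
def receiverUtility (a ω : I) : ℝ := -((a : ℝ) - (ω : ℝ)) ^ 2

/-- The prior over states: the uniform distribution (Lebesgue measure) on `[0, 1]`. -/
def prior : Measure I := volume

/-- Sender's ex-ante expected payoff `∫∫∫ u(a, ω) α(da|s) π(ds|ω) p(dω)` when the information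
structure is `π` and the receiver's strategy is `α`. -/
def senderPayoff (b : ℝ) (π α : Kernel I I) : ℝ :=
  ∫ ω, ∫ s, ∫ a, senderUtility b a ω ∂(α s) ∂(π ω) ∂prior

/-- Receiver's expected payoff `∫∫ v(a, ω) ν(da) l(dω)` of the mixed action `ν` under belief `l`. -/
def receiverPayoff (ν l : Measure I) : ℝ :=
  ∫ ω, ∫ a, receiverUtility a ω ∂ν ∂l

/-- `π` is a best response to `α` among all information structures. -/
def SenderOptimal (b : ℝ) (π α : Kernel I I) : Prop :=
  ∀ μ : Kernel I I, IsMarkovKernel μ → senderPayoff b μ α ≤ senderPayoff b π α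

/-- At every signal, `α` is a best response to the belief system `bel` among all mixed actions. -/
def ReceiverOptimal (α bel : Kernel I I) : Prop :=
  ∀ s : I, ∀ ν : Measure I, IsProbabilityMeasure ν →
    receiverPayoff ν (bel s) ≤ receiverPayoff (α s) (bel s)

/-- The law `γ` of the signal under `π`. -/
def signalLaw (π : Kernel I I) : Measure I := π ∘ₘ prior

/-- Bayes' rule on a continuum: `p(dω) π(ds|ω) = γ(ds) bel(dω|s)`, i.e. `bel` is a regular
conditional distribution of the state given the signal (unrestricted on `γ`-null sets of
signals). -/
def BayesConsistent (π bel : Kernel I I) : Prop :=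
  (prior ⊗ₘ π).map Prod.swap = signalLaw π ⊗ₘ bel

/-- Perfect Bayesian equilibrium of the covert-signaling game. -/
structure IsPBE (b : ℝ) (π α bel : Kernel I I) : Prop where
  markov_info : IsMarkovKernel π
  markov_action : IsMarkovKernel α
  markov_belief : IsMarkovKernel bel
  sender_optimal : SenderOptimal b π α
  receiver_optimal : ReceiverOptimal α bel
  consistent : BayesConsistent π bel

/-- Feasible triples in overt persuasion: an arbitrary, publicly announced information structure
`π`, the beliefs it induces by Bayes' rule, and a best response of the receiver to them. -/
structure IsOvertFeasible (π α bel : Kernel I I) : Prop where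
  markov_info : IsMarkovKernel π
  markov_action : IsMarkovKernel α
  markov_belief : IsMarkovKernel bel
  receiver_optimal : ReceiverOptimal α bel
  consistent : BayesConsistent π bel

/-- The sender's payoffs over all perfect Bayesian equilibria of covert signaling. -/
def covertPayoffs (b : ℝ) : Set ℝ :=
  {x | ∃ π α bel : Kernel I I, IsPBE b π α bel ∧ x = senderPayoff b π α}

/-- The sender's feasible payoffs in overt persuasion. -/
def overtPayoffs (b : ℝ) : Set ℝ :=
  {x | ∃ π α bel : Kernel I I, IsOvertFeasible π α bel ∧ x = senderPayoff b π α}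

/-- `U^CS`: the best covert-signaling equilibrium payoff of the sender. -/
def covertValue (b : ℝ) : ℝ := sSup (covertPayoffs b)

/-- `U^OP`: the optimal value of overt persuasion. -/
def overtValue (b : ℝ) : ℝ := sSup (overtPayoffs b)

/-- Price of transparency associated with a covert equilibrium payoff `x`. All payoffs in this game
are non-positive (they are minus losses), so the ratio of the covert to the overt outcome is oriented
as overt loss over covert loss: small values mean that overt persuasion is far better. -/
def priceOfTransparency (b x : ℝ) : ℝ := overtValue b / x

/-- `N(b) = ⌈-1/2 + (1/2) √(1 + 2/b)⌉`, the maximal number of cells of a partition equilibrium. -/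
def maxCells (b : ℝ) : ℕ := ⌈-(1 / 2 : ℝ) + (1 / 2) * Real.sqrt (1 + 2 / b)⌉₊

/-- Partition signaling with cells given by `0 = k 0 < k 1 < ⋯ < k N = 1`: a state in the open cell
`(k i, k (i+1))` is answered by a signal drawn uniformly from that cell. -/
structure IsPartitionSignaling (N : ℕ) (k : ℕ → ℝ) (π : Kernel I I) : Prop where
  first : k 0 = 0
  last : k N = 1
  strict : ∀ i < N, k i < k (i + 1)
  uniform : ∀ i < N, ∀ ω : I, (ω : ℝ) ∈ Set.Ioo (k i) (k (i + 1)) →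
    π ω = ProbabilityTheory.cond (volume : Measure I)
      ((fun s : I => (s : ℝ)) ⁻¹' Set.Ioo (k i) (k (i + 1)))

end QCG

end

/-!
The receiver's unique best response to a belief is its mean, so an information structure `π` with
beliefs `bel` induces the action `X = posteriorMean bel s`, an unbiased prediction of the state `ω`
given the signal, and the sender's payoff is `-b² - E (X - ω)²` (`senderPayoff_eq_of_consistent`).
Under commitment only the second term can be influenced, and full revelation makes it vanish.

In covert signaling almost every state must get the available action closest to `ω + b`
(`SenderOptimal.ae_le`); otherwise replacing the signal by a better one is a profitable deviation.
Averaging this constraint over the posterior gives `d (d - 2 b) ≥ 0` for the difference `d` of two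
equilibrium actions (`IsPBE.ae_gap`). So the support of the law of `X` is `2b`-separated, hence
finite and made of atoms (`exists_loss_eq`). Its `n` points are the midpoints of `n` consecutive
intervals of states, and the indifference of the cutoff states forces the lengths of the intervals to
grow by `4 b` at each step (`loss_of_enumeration`). Since the lengths are positive and add up to `1`,
`2 b n (n - 1) < 1`, that is `n ≤ N(b)`, and `E (X - ω)²` is
`partitionLoss b n = 1 / (12 n²) + b² (n² - 1) / 3`, which decreases in `n` in this range
(`partitionLoss_le`).

Conversely the partition with `N(b)` such cells is an equilibrium (`exists_partition_PBE`): the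
kernel that draws uniformly from the cell of its argument is reversible for the prior, so it is its
own system of posteriors. Finally `b² + partitionLoss b n ≥ b / 3` for every `n` by the
arithmetic-geometric mean inequality (`third_le_loss`), while `N(b)` is of order `b ^ (-1/2)`, which
gives the matching upper bound; the price of transparency is therefore at most `3 b`.
-/

noncomputable section

namespace QCG

/-! ### Quadratic loss and the posterior mean -/

lemma integrable_of_continuous (l : Measure I) [IsFiniteMeasure l] {f : I → ℝ}
    (hf : Continuous f) : Integrable f l :=
  hf.integrable_of_hasCompactSupport (HasCompactSupport.of_compactSpace f)

/-- The mean `∫ ω dl` of a belief, as an action; for a probability measure the projection onto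
`[0, 1]` does nothing (`coe_meanAction`). -/
def meanAction (l : Measure I) : I := Set.projIcc 0 1 zero_le_one (∫ ω, (ω : ℝ) ∂l)

lemma coe_meanAction (l : Measure I) [IsProbabilityMeasure l] :
    (meanAction l : ℝ) = ∫ ω, (ω : ℝ) ∂l := by
  have h0 : 0 ≤ ∫ ω, (ω : ℝ) ∂l := integral_nonneg fun ω => ω.2.1
  have h1 : ∫ ω, (ω : ℝ) ∂l ≤ 1 := by
    have := integral_mono (integrable_of_continuous l continuous_subtype_val)
      (integrable_const (1 : ℝ)) (fun ω : I => ω.2.2)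
    simpa using this
  simp [meanAction, Set.projIcc_of_mem _ (Set.mem_Icc.2 ⟨h0, h1⟩)]

/-- The receiver's action after signal `s` under the belief system `bel`. -/
def posteriorMean (bel : Kernel I I) (s : I) : I := meanAction (bel s)

@[fun_prop]
lemma measurable_posteriorMean (bel : Kernel I I) : Measurable (posteriorMean bel) := by
  have h : StronglyMeasurable fun s => ∫ ω, (ω : ℝ) ∂bel s :=
    StronglyMeasurable.integral_kernel measurable_subtype_coe.stronglyMeasurable
  exact continuous_projIcc.measurable.comp h.measurable

lemma integral_sub_meanAction (l : Measure I) [IsProbabilityMeasure l] :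
    ∫ ω, ((ω : ℝ) - meanAction l) ∂l = 0 := by
  rw [integral_sub (integrable_of_continuous l continuous_subtype_val) (integrable_const _),
    coe_meanAction]
  simp

lemma integral_sub_posteriorMean (bel : Kernel I I) [IsMarkovKernel bel] (s : I) :
    ∫ ω, ((ω : ℝ) - posteriorMean bel s) ∂(bel s) = 0 :=
  integral_sub_meanAction (bel s)

/-- Bias-variance decomposition of the receiver's loss. -/
lemma receiverPayoff_eq (ν l : Measure I) [IsProbabilityMeasure ν] [IsProbabilityMeasure l] :
    receiverPayoff ν l = -(∫ a, ((a : ℝ) - meanAction l) ^ 2 ∂ν)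
      - ∫ ω, ((ω : ℝ) - meanAction l) ^ 2 ∂l := by
  set M : ℝ := (meanAction l : ℝ) with hM
  have inner (ω : I) : ∫ a, receiverUtility a ω ∂ν =
      -(∫ a, ((a : ℝ) - M) ^ 2 ∂ν) + 2 * (∫ a, ((a : ℝ) - M) ∂ν) * ((ω : ℝ) - M)
        - ((ω : ℝ) - M) ^ 2 := by
    have e : ∀ a : I, receiverUtility a ω =
        (-((a : ℝ) - M) ^ 2 + (2 * ((ω : ℝ) - M)) * ((a : ℝ) - M)) - ((ω : ℝ) - M) ^ 2 := by
      intro a; simp only [receiverUtility]; ring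
    simp only [e]
    rw [integral_sub (integrable_of_continuous ν (by fun_prop)) (integrable_const _),
      integral_add (integrable_of_continuous ν (by fun_prop))
        (integrable_of_continuous ν (by fun_prop)), integral_neg, integral_const_mul]
    simp only [integral_const, probReal_univ, one_smul]
    ring
  simp only [receiverPayoff, inner]
  rw [integral_sub (integrable_of_continuous l (by fun_prop))
      (integrable_of_continuous l (by fun_prop)),
    integral_add (integrable_const _) (integrable_of_continuous l (by fun_prop)),
    integral_const_mul, integral_sub_meanAction l]
  simp

/-- The unique best response of the receiver is the posterior mean, because it strictly minimizes
the expected quadratic loss. -/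
lemma ReceiverOptimal.ae_eq {α bel : Kernel I I} [IsMarkovKernel α] [IsMarkovKernel bel]
    (h : ReceiverOptimal α bel) (s : I) : ∀ᵐ a ∂(α s), a = posteriorMean bel s := by
  have h1 := h s (Measure.dirac (posteriorMean bel s)) inferInstance
  rw [receiverPayoff_eq, receiverPayoff_eq, integral_dirac, ← posteriorMean, sub_self] at h1
  have hi : Integrable (fun a : I => ((a : ℝ) - posteriorMean bel s) ^ 2) (α s) :=
    integrable_of_continuous _ (by fun_prop)
  have h2 : ∫ a, ((a : ℝ) - posteriorMean bel s) ^ 2 ∂(α s) = 0 := by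
    apply le_antisymm _ (integral_nonneg fun a => sq_nonneg _)
    linarith
  rw [integral_eq_zero_iff_of_nonneg (fun a => sq_nonneg _) hi] at h2
  filter_upwards [h2] with a ha
  simp only [Pi.zero_apply, pow_eq_zero_iff, ne_eq, OfNat.ofNat_ne_zero, not_false_eq_true,
    sub_eq_zero] at ha
  exact Subtype.ext ha

/-- Playing the posterior mean is a best response. -/
lemma receiverOptimal_of_eq_dirac {α bel : Kernel I I} [IsMarkovKernel bel]
    (h : ∀ s, α s = Measure.dirac (posteriorMean bel s)) : ReceiverOptimal α bel := by
  intro s ν _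
  rw [h s, receiverPayoff_eq, receiverPayoff_eq, integral_dirac, ← posteriorMean, sub_self]
  have : 0 ≤ ∫ a, ((a : ℝ) - posteriorMean bel s) ^ 2 ∂ν := integral_nonneg fun a => sq_nonneg _
  linarith

instance : IsProbabilityMeasure prior := inferInstanceAs (IsProbabilityMeasure (volume : Measure I))

/-! ### Payoffs in terms of the induced action -/

lemma integrable_sq_loss {Ω : Type*} [MeasurableSpace Ω] (P : Measure Ω) [IsFiniteMeasure P]
    {W X : Ω → I} (hW : Measurable W) (hX : Measurable X) (b : ℝ) :
    Integrable (fun z => ((X z : ℝ) - W z - b) ^ 2) P := by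
  refine Integrable.of_bound (C := (2 + |b|) ^ 2) (by fun_prop) (ae_of_all _ fun z => ?_)
  rw [Real.norm_eq_abs, abs_pow]
  have h1 := (X z).2
  have h2 := (W z).2
  gcongr
  have := abs_le.1 (le_refl |b|)
  exact abs_le.2 ⟨by linarith [h1.1, h1.2, h2.1, h2.2], by linarith [h1.1, h1.2, h2.1, h2.2]⟩

/-- If the receiver answers every signal `s` with the action `m s`, the sender's payoff is minus the
mean squared distance of the action from the sender's ideal point. -/
lemma senderPayoff_eq (b : ℝ) (μ α : Kernel I I) [IsMarkovKernel μ] [IsMarkovKernel α] {m : I → I}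
    (hm : Measurable m) (h : ∀ s, ∀ᵐ a ∂(α s), a = m s) :
    senderPayoff b μ α = -∫ z, ((m z.2 : ℝ) - z.1 - b) ^ 2 ∂(prior ⊗ₘ μ) := by
  have inner (ω s : I) : ∫ a, senderUtility b a ω ∂(α s) = -((m s : ℝ) - ω - b) ^ 2 := by
    have : (fun a => senderUtility b a ω) =ᵐ[α s] fun _ => -((m s : ℝ) - ω - b) ^ 2 := by
      filter_upwards [h s] with a ha
      rw [ha, senderUtility]
    rw [integral_congr_ae this]
    simp
  simp only [senderPayoff, inner]
  rw [← integral_neg, Measure.integral_compProd]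
  exact (integrable_sq_loss _ measurable_fst (hm.comp measurable_snd) b).neg

lemma measurable_fst_sub {m : I → I} (hm : Measurable m) :
    Measurable fun z : I × I => (z.1 : ℝ) - m z.2 := by
  fun_prop

lemma measurable_sq_loss {m : I → I} (hm : Measurable m) (b : ℝ) :
    Measurable fun z : I × I => ((m z.2 : ℝ) - z.1 - b) ^ 2 := by
  fun_prop

lemma integrable_fst_sub (P : Measure (I × I)) [IsFiniteMeasure P] {m : I → I}
    (hm : Measurable m) : Integrable (fun z => (z.1 : ℝ) - m z.2) P := by
  refine Integrable.of_bound (C := 2) (by fun_prop) (ae_of_all _ fun z => ?_)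
  have h1 := (m z.2).2
  have h2 := z.1.2
  exact abs_le.2 ⟨by linarith [h1.1, h1.2, h2.1, h2.2], by linarith [h1.1, h1.2, h2.1, h2.2]⟩

/-- Under Bayes-consistency, an almost sure property of (state, signal) holds almost surely under
the belief at almost every signal. -/
lemma BayesConsistent.ae_ae {π bel : Kernel I I} [IsMarkovKernel π] [IsMarkovKernel bel]
    (h : BayesConsistent π bel) {p : I × I → Prop} (hp : ∀ᵐ z ∂(prior ⊗ₘ π), p z)
    (hpm : MeasurableSet {z | p z}) :
    ∀ᵐ z ∂(prior ⊗ₘ π), ∀ᵐ ω ∂(bel z.2), p (ω, z.2) := by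
  have h1 : ∀ᵐ y ∂(signalLaw π ⊗ₘ bel), p y.swap := by
    rw [← h, ae_map_iff measurable_swap.aemeasurable (p := fun y => p y.swap)
      (measurable_swap hpm)]
    simpa using hp
  have : IsFiniteMeasure (signalLaw π) := by unfold signalLaw; infer_instance
  have h2 := Measure.ae_ae_of_ae_compProd h1
  have h3 : signalLaw π = (prior ⊗ₘ π).map Prod.snd := by
    rw [signalLaw, ← Measure.snd_compProd, Measure.snd]
  rw [h3] at h2
  exact ae_of_ae_map measurable_snd.aemeasurable h2

/-- The action induced by Bayesian updating is an unbiased prediction of the state, conditionally on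
the signal. -/
lemma BayesConsistent.setIntegral_sub {π bel : Kernel I I} [IsMarkovKernel π] [IsMarkovKernel bel]
    (h : BayesConsistent π bel) {B : Set I} (hB : MeasurableSet B) :
    ∫ z in Prod.snd ⁻¹' B, ((z.1 : ℝ) - posteriorMean bel z.2) ∂(prior ⊗ₘ π) = 0 := by
  have hm := measurable_posteriorMean bel
  have hP : prior ⊗ₘ π = (signalLaw π ⊗ₘ bel).map Prod.swap := by
    rw [← h, Measure.map_map measurable_swap measurable_swap]
    simp
  have : IsFiniteMeasure (signalLaw π) := by unfold signalLaw; infer_instance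
  rw [← integral_indicator (measurable_snd hB), hP, integral_map measurable_swap.aemeasurable
    (by
      apply Measurable.aestronglyMeasurable
      exact (measurable_fst_sub hm).indicator (measurable_snd hB))]
  rw [Measure.integral_compProd]
  · apply integral_eq_zero_of_ae
    refine ae_of_all _ fun s => ?_
    by_cases hs : s ∈ B
    · simpa [Set.indicator, hs] using integral_sub_posteriorMean bel s
    · simp [Set.indicator, hs]
  · have h1 : Integrable (fun z : I × I => (z.1 : ℝ) - posteriorMean bel z.2) (prior ⊗ₘ π) :=
      integrable_fst_sub _ hm
    have h2 := h1.indicator (measurable_snd hB)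
    rw [hP] at h2
    exact h2.comp_measurable measurable_swap

/-- The bias costs the sender `b²` on top of the loss from imprecise information. -/
lemma senderPayoff_eq_of_consistent (b : ℝ) {π α bel : Kernel I I} [IsMarkovKernel π]
    [IsMarkovKernel α] [IsMarkovKernel bel] (hr : ReceiverOptimal α bel)
    (h : BayesConsistent π bel) :
    senderPayoff b π α =
      -b ^ 2 - ∫ z, ((posteriorMean bel z.2 : ℝ) - z.1) ^ 2 ∂(prior ⊗ₘ π) := by
  have hm := measurable_posteriorMean bel
  rw [senderPayoff_eq b π α hm hr.ae_eq]
  have e : ∀ z : I × I, ((posteriorMean bel z.2 : ℝ) - z.1 - b) ^ 2 =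
      (((posteriorMean bel z.2 : ℝ) - z.1 - 0) ^ 2 +
        2 * b * ((z.1 : ℝ) - posteriorMean bel z.2)) + b ^ 2 := fun z => by ring
  have i1 := integrable_sq_loss (prior ⊗ₘ π) measurable_fst (hm.comp measurable_snd) 0
  simp only [Function.comp_apply] at i1
  have i2 := (integrable_fst_sub (prior ⊗ₘ π) hm).const_mul (2 * b)
  have h0 := h.setIntegral_sub MeasurableSet.univ
  rw [Set.preimage_univ, Measure.restrict_univ] at h0
  simp only [e]
  rw [integral_add (by exact i1.add i2) (integrable_const _), integral_add i1 i2, integral_const_mul, h0]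
  simp only [integral_const, probReal_univ, one_smul, sub_zero]
  ring

/-! ### The sender's incentive constraint -/

/-- In equilibrium almost no sender type would gain by sending a fixed other signal `t`: otherwise
the information structure that replaces the signal by `t` whenever `t` is better would be a
profitable deviation. -/
lemma SenderOptimal.ae_le {b : ℝ} {π α : Kernel I I} [IsMarkovKernel π] [IsMarkovKernel α]
    {m : I → I} (hm : Measurable m) (hα : ∀ s, ∀ᵐ a ∂(α s), a = m s)
    (h : SenderOptimal b π α) (t : I) :
    ∀ᵐ z ∂(prior ⊗ₘ π), ((m z.2 : ℝ) - z.1 - b) ^ 2 ≤ ((m t : ℝ) - z.1 - b) ^ 2 := by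
  classical
  set D : Set (I × I) := {z | ((m t : ℝ) - z.1 - b) ^ 2 < ((m z.2 : ℝ) - z.1 - b) ^ 2} with hD
  have hDm : MeasurableSet D := measurableSet_lt (by fun_prop) (by fun_prop)
  set g : I × I → I := fun z => if z ∈ D then t else z.2 with hg
  have hgm : Measurable g := Measurable.ite hDm measurable_const measurable_snd
  let μ : Kernel I I := (Kernel.id ×ₖ π).map g
  have hμ : IsMarkovKernel μ := Kernel.IsMarkovKernel.map _ hgm
  have key : prior ⊗ₘ μ = (prior ⊗ₘ π).map (fun z => (z.1, g z)) := by
    refine Measure.ext_prod fun {A B} hA hB => ?_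
    rw [Measure.compProd_apply_prod hA hB, Measure.map_apply (by fun_prop) (hA.prod hB),
      Measure.compProd_apply (by measurability), ← lintegral_indicator hA]
    refine lintegral_congr fun ω => ?_
    by_cases hω : ω ∈ A
    · simp only [Set.indicator_of_mem hω, μ]
      rw [Kernel.map_apply' _ hgm _ hB, Kernel.prod_apply, Kernel.id_apply,
        Measure.dirac_prod, Measure.map_apply (by fun_prop) (hgm hB)]
      congr 1
      ext s
      simp [hω]
    · simp only [Set.indicator_of_notMem hω]
      symm
      convert measure_empty (μ := π ω)
      ext s
      simp [hω]
  have h1 := h μ hμ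
  rw [senderPayoff_eq b μ α hm hα, senderPayoff_eq b π α hm hα, key,
    integral_map (by fun_prop) (by
      apply Measurable.aestronglyMeasurable
      fun_prop)] at h1
  simp only at h1
  have i1 := integrable_sq_loss (prior ⊗ₘ π) measurable_fst (hm.comp measurable_snd) b
  have i2 := integrable_sq_loss (prior ⊗ₘ π) measurable_fst (hm.comp hgm) b
  have le : ∀ z : I × I, ((m (g z) : ℝ) - z.1 - b) ^ 2 ≤ ((m z.2 : ℝ) - z.1 - b) ^ 2 := by
    intro z
    by_cases hz : z ∈ D
    · simpa [hg, hz] using hz.le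
    · simp [hg, hz]
  have h2 := (integral_eq_iff_of_ae_le i2 i1 (ae_of_all _ le)).1
    (le_antisymm (integral_mono i2 i1 le) (by simpa using h1))
  filter_upwards [h2] with z hz
  by_contra hc
  have hzD : z ∈ D := not_le.1 hc
  have : ((m t : ℝ) - z.1 - b) ^ 2 = ((m z.2 : ℝ) - z.1 - b) ^ 2 := by
    simpa [hg, hzD] using hz
  exact absurd this (ne_of_lt hzD)

/-- Equilibrium actions are spaced at least `2b` apart: averaging the incentive constraint over the
posterior belief, whose mean is the action itself, leaves `d (d - 2b) ≥ 0` for the difference `d`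
of two actions. -/
lemma IsPBE.ae_gap {b : ℝ} {π α bel : Kernel I I} (h : IsPBE b π α bel) (t : I) :
    ∀ᵐ z ∂(prior ⊗ₘ π), 0 ≤ ((posteriorMean bel t : ℝ) - posteriorMean bel z.2) *
      ((posteriorMean bel t : ℝ) - posteriorMean bel z.2 - 2 * b) := by
  have := h.markov_info
  have := h.markov_action
  have := h.markov_belief
  have hm := measurable_posteriorMean bel
  have h1 := h.sender_optimal.ae_le hm h.receiver_optimal.ae_eq t
  have h2 := h.consistent.ae_ae h1 (measurableSet_le (measurable_sq_loss hm b) (by fun_prop))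
  filter_upwards [h2] with z hz
  set x : ℝ := (posteriorMean bel z.2 : ℝ) with hx
  set y : ℝ := (posteriorMean bel t : ℝ)
  have h3 : 0 ≤ ∫ ω, ((y - x) * (y - x - 2 * b) - 2 * (y - x) * ((ω : ℝ) - x)) ∂(bel z.2) := by
    refine integral_nonneg_of_ae ?_
    filter_upwards [hz] with ω hω
    simp only [Pi.zero_apply]
    nlinarith
  rw [integral_sub (integrable_const _) (integrable_of_continuous _ (by fun_prop)),
    integral_const_mul (2 * (y - x)), integral_sub_posteriorMean] at h3
  simpa using h3

/-! ### Arithmetic of partitions into cells -/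

/-- Expected squared distance between state and cell midpoint for the partition of `[0, 1]` into
`n` cells whose lengths increase by `4 b` from each cell to the next. -/
def partitionLoss (b : ℝ) (n : ℕ) : ℝ := 1 / (12 * (n : ℝ) ^ 2) + b ^ 2 * ((n : ℝ) ^ 2 - 1) / 3

lemma sum_cube_arith (l d : ℝ) (n : ℕ) :
    ∑ j ∈ Finset.range n, (l + d * j) ^ 3 =
      n * l ^ 3 + 3 * d * l ^ 2 * (n * (n - 1) / 2) + 3 * d ^ 2 * l * ((n - 1) * n * (2 * n - 1) / 6)
        + d ^ 3 * (n * (n - 1) / 2) ^ 2 := by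
  induction n with
  | zero => simp
  | succ n ih =>
    rw [Finset.sum_range_succ, ih]
    push_cast
    ring

/-- The sum of cubes of cell lengths in arithmetic progression with total length `1`. -/
lemma sum_cube_cells {b l : ℝ} {n : ℕ} (hn : 0 < n) (h : n * l + 2 * b * (n * (n - 1)) = 1) :
    ∑ j ∈ Finset.range n, (l + 4 * b * j) ^ 3 / 12 = partitionLoss b n := by
  have hn' : (n : ℝ) ≠ 0 := by positivity
  have hl : l = (1 - 2 * b * (n * (n - 1))) / n := by
    field_simp
    linarith
  rw [← Finset.sum_div, sum_cube_arith, partitionLoss, hl]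
  field_simp
  ring

lemma chain_lt {c : ℕ → ℝ} {n : ℕ} (hc : ∀ j < n, c j < c (j + 1)) {i j : ℕ} (hij : i < j)
    (hj : j ≤ n) : c i < c j := by
  induction j, hij using Nat.le_induction with
  | base => exact hc i (by omega)
  | succ k hk ih => exact (ih (by omega)).trans (hc k (by omega))

lemma chain_le {c : ℕ → ℝ} {n : ℕ} (hc : ∀ j < n, c j < c (j + 1)) {i j : ℕ} (hij : i ≤ j)
    (hj : j ≤ n) : c i ≤ c j := by
  rcases hij.eq_or_lt with rfl | h
  · exact le_rfl
  · exact (chain_lt hc h hj).le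

lemma exists_cell {c : ℕ → ℝ} {n : ℕ} {w : ℝ} (h0 : c 0 ≤ w) (hn : w < c n) :
    ∃ j < n, c j ≤ w ∧ w < c (j + 1) := by
  induction n with
  | zero => exact absurd hn (not_lt.2 h0)
  | succ n ih =>
    by_cases h : w < c n
    · obtain ⟨j, hj, hw⟩ := ih h
      exact ⟨j, by omega, hw⟩
    · exact ⟨n, by omega, not_lt.1 h, hn⟩

lemma integral_sq_sub_midpoint (u v : ℝ) :
    ∫ w in u..v, ((u + v) / 2 - w) ^ 2 = (v - u) ^ 3 / 12 := by
  have e : ∀ w : ℝ, ((u + v) / 2 - w) ^ 2 = (w - (u + v) / 2) ^ 2 := fun w => by ring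
  simp only [e]
  rw [intervalIntegral.integral_comp_sub_right (fun w => w ^ 2), integral_pow]
  norm_num
  ring

/-! ### Uniformly distributed states -/

section Uniform

variable {Ω : Type*} [MeasurableSpace Ω] {P : Measure Ω} {W X : Ω → ℝ}

lemma exists_mem_of_ae {S : Set Ω} (hS : P S ≠ 0) {p : Ω → Prop} (hp : ∀ᵐ z ∂P, p z) :
    ∃ z ∈ S, p z :=
  ((frequently_ae_mem_iff.2 hS).and_eventually hp).exists

lemma ae_mem_Icc_of_uniform (hW : Measurable W) (hlaw : P.map W = volume.restrict (Set.Icc 0 1)) :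
    ∀ᵐ z ∂P, W z ∈ Set.Icc (0 : ℝ) 1 := by
  refine ae_of_ae_map hW.aemeasurable ?_
  rw [hlaw]
  exact ae_restrict_mem measurableSet_Icc

lemma ae_ne_of_uniform (hW : Measurable W) (hlaw : P.map W = volume.restrict (Set.Icc 0 1))
    (c : ℕ → ℝ) : ∀ᵐ z ∂P, ∀ j, W z ≠ c j := by
  refine ae_all_iff.2 fun j => ae_of_ae_map (p := fun w => w ≠ c j) hW.aemeasurable ?_
  rw [hlaw]
  exact ae_restrict_of_ae (Measure.ae_ne volume (c j))

lemma setIntegral_of_uniform (hW : Measurable W)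
    (hlaw : P.map W = volume.restrict (Set.Icc 0 1)) {u v : ℝ} (hu : 0 ≤ u) (huv : u ≤ v)
    (hv : v ≤ 1) {g : ℝ → ℝ} (hg : Continuous g) :
    ∫ z in W ⁻¹' Set.Ioo u v, g (W z) ∂P = ∫ w in u..v, g w := by
  have hsub : Set.Ioo u v ⊆ Set.Icc 0 1 := fun w hw => ⟨hu.trans hw.1.le, hw.2.le.trans hv⟩
  rw [← setIntegral_map measurableSet_Ioo hg.aestronglyMeasurable hW.aemeasurable, hlaw,
    Measure.restrict_restrict measurableSet_Ioo, Set.inter_eq_left.2 hsub,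
    intervalIntegral.integral_of_le huv, integral_Ioc_eq_integral_Ioo]

/-- If the state `W` is uniform on `[0, 1]` and `X` is the midpoint of the cell containing `W`, the
mean squared error of `X` is the sum of the cubes of the cell lengths over `12`. -/
lemma integral_sq_sub_of_cells (hW : Measurable W)
    (hlaw : P.map W = volume.restrict (Set.Icc 0 1)) (hi : Integrable (fun z => (X z - W z) ^ 2) P)
    {n : ℕ} {c : ℕ → ℝ} (h0 : c 0 = 0) (h1 : c n = 1) (hc : ∀ j < n, c j < c (j + 1))
    (hX : ∀ᵐ z ∂P, ∀ j < n, W z ∈ Set.Ioo (c j) (c (j + 1)) → X z = (c j + c (j + 1)) / 2) :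
    ∫ z, (X z - W z) ^ 2 ∂P = ∑ j ∈ Finset.range n, (c (j + 1) - c j) ^ 3 / 12 := by
  have hcov : ∀ᵐ z ∂P, z ∈ ⋃ j ∈ Finset.range n, W ⁻¹' Set.Ioo (c j) (c (j + 1)) := by
    filter_upwards [ae_mem_Icc_of_uniform hW hlaw, ae_ne_of_uniform hW hlaw c] with z hz hne
    obtain ⟨j, hj, hj1, hj2⟩ := exists_cell (c := c) (n := n) (w := W z) (by rw [h0]; exact hz.1)
      (lt_of_le_of_ne (by rw [h1]; exact hz.2) (hne n))
    simp only [Set.mem_iUnion, Finset.mem_range]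
    exact ⟨j, hj, lt_of_le_of_ne hj1 (hne j).symm, hj2⟩
  rw [← Measure.restrict_eq_self_of_ae_mem hcov, integral_biUnion_finset]
  · refine Finset.sum_congr rfl fun j hj => ?_
    have hj' : j < n := Finset.mem_range.1 hj
    rw [← integral_sq_sub_midpoint, ← setIntegral_of_uniform hW hlaw
      (g := fun w => ((c j + c (j + 1)) / 2 - w) ^ 2)
      (by rw [← h0]; exact chain_le hc (Nat.zero_le _) hj'.le) (hc j hj').le
      (by rw [← h1]; exact chain_le hc hj' le_rfl) (by fun_prop)]
    refine setIntegral_congr_ae (hW measurableSet_Ioo) ?_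
    filter_upwards [hX] with z hz hzj
    rw [hz j hj' hzj]
  · exact fun j _ => hW measurableSet_Ioo
  · intro i hi' j hj' hij
    simp only [Finset.coe_range, Set.mem_Iio] at hi' hj'
    rw [Function.onFun, Set.disjoint_left]
    intro z hz hz'
    rcases lt_or_gt_of_ne hij with h | h
    · linarith [chain_le hc h hj'.le, hz.2, hz'.1]
    · linarith [chain_le hc h hi'.le, hz.1, hz'.2]
  · exact fun j _ => hi.integrableOn

end Uniform

/-! ### Equilibrium actions form a finite set that partitions the states into cells -/

section Cells

variable {Ω : Type*} [MeasurableSpace Ω] {P : Measure Ω} [IsProbabilityMeasure P] {W X : Ω → ℝ}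
  {b : ℝ}

/-- Suppose `X` takes exactly the values `x 0 < ⋯ < x (n - 1)`, predicts the uniform state `W`
without bias conditionally on `X`, and each state gets the value closest to `W + b`. Then each value
is taken on an interval of states with that value as midpoint, indifference at the cutoffs makes the
lengths of the intervals increase by `4 b`, and this determines the mean squared error. -/
lemma loss_of_enumeration (hW : Measurable W)
    (hlaw : P.map W = volume.restrict (Set.Icc 0 1))
    (hi : Integrable (fun z => (X z - W z) ^ 2) P)
    (hmean : ∀ x, ∫ z in X ⁻¹' {x}, (W z - X z) ∂P = 0)
    {n : ℕ} {x : ℕ → ℝ} (hx : ∀ i j, i < j → j < n → x i < x j)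
    (hpos : ∀ j < n, P (X ⁻¹' {x j}) ≠ 0) (hcov : ∀ᵐ z ∂P, ∃ j < n, X z = x j)
    (hIC : ∀ i < n, ∀ᵐ z ∂P, (X z - W z - b) ^ 2 ≤ (x i - W z - b) ^ 2) :
    0 < n ∧ 2 * b * (n * (n - 1)) < 1 ∧ ∫ z, (X z - W z) ^ 2 ∂P = partitionLoss b n := by
  have hn : 0 < n := by
    obtain ⟨z, j, hj, -⟩ := hcov.exists
    omega
  set c : ℕ → ℝ := fun j => if j = 0 then 0 else if j < n then (x (j - 1) + x j) / 2 - b else 1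
    with hcdef
  have c0 : c 0 = 0 := by simp [hcdef]
  have cn : c n = 1 := by simp [hcdef, hn.ne']
  have cmid : ∀ j, j + 1 < n → c (j + 1) = (x j + x (j + 1)) / 2 - b := by
    intro j hj
    simp [hcdef, hj]
  -- the action `x j` is best only for states between its two neighbouring cutoffs
  have hD : ∀ᵐ z ∂P, ∀ j < n, X z = x j → W z ∈ Set.Icc (c j) (c (j + 1)) := by
    have hIC' : ∀ᵐ z ∂P, ∀ i, i < n → (X z - W z - b) ^ 2 ≤ (x i - W z - b) ^ 2 := by
      refine ae_all_iff.2 fun i => ?_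
      by_cases hin : i < n
      · filter_upwards [hIC i hin] with z hz _ using hz
      · exact ae_of_all _ fun z h => absurd h hin
    filter_upwards [hIC', ae_mem_Icc_of_uniform hW hlaw] with z hz hz01 j hj hXj
    constructor
    · rcases j with _ | j
      · rw [c0]; exact hz01.1
      · have h1 := hz j (by omega)
        have h2 := hx j (j + 1) (by omega) hj
        rw [cmid j hj]
        rw [hXj] at h1
        nlinarith
    · rcases Nat.lt_or_ge (j + 1) n with h | h
      · have h1 := hz (j + 1) h
        have h2 := hx j (j + 1) (by omega) h
        rw [cmid j h]
        rw [hXj] at h1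
        nlinarith
      · rw [show j + 1 = n by omega, cn]; exact hz01.2
  -- a degenerate cell would be a single state, which has probability zero
  have hc : ∀ j < n, c j < c (j + 1) := by
    intro j hj
    obtain ⟨z, hz, hz1, hz2⟩ := exists_mem_of_ae (hpos j hj) (hD.and (ae_ne_of_uniform hW hlaw c))
    have h1 := hz1 j hj hz
    exact lt_of_lt_of_le (lt_of_le_of_ne h1.1 (hz2 j).symm) h1.2
  have hF : ∀ᵐ z ∂P, ∀ j < n, W z ∈ Set.Ioo (c j) (c (j + 1)) → X z = x j := by
    filter_upwards [hD, hcov] with z hz hzc j hj hWj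
    obtain ⟨i, hin, hXi⟩ := hzc
    have h1 := hz i hin hXi
    rcases lt_trichotomy i j with h | h | h
    · linarith [chain_le hc (show i + 1 ≤ j from h) hj.le, h1.2, hWj.1]
    · rw [hXi, h]
    · linarith [chain_le hc (show j + 1 ≤ i from h) hin.le, h1.1, hWj.2]
  have hc0 : ∀ j < n, 0 ≤ c j := fun j hj => c0 ▸ chain_le hc (Nat.zero_le _) hj.le
  have hc1 : ∀ j < n, c (j + 1) ≤ 1 := fun j hj => cn ▸ chain_le hc hj le_rfl
  have hxmid : ∀ j < n, x j = (c j + c (j + 1)) / 2 := by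
    intro j hj
    have hset : X ⁻¹' {x j} =ᵐ[P] W ⁻¹' Set.Ioo (c j) (c (j + 1)) := by
      filter_upwards [hD, hF, ae_ne_of_uniform hW hlaw c] with z hz1 hz2 hz3
      refine propext ⟨fun h => ?_, fun h => hz2 j hj h⟩
      have h1 := hz1 j hj h
      exact ⟨lt_of_le_of_ne h1.1 (hz3 j).symm, lt_of_le_of_ne h1.2 (hz3 (j + 1))⟩
    have h1 := hmean (x j)
    rw [setIntegral_congr_set hset] at h1
    have h2 : ∫ z in W ⁻¹' Set.Ioo (c j) (c (j + 1)), (W z - X z) ∂P =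
        ∫ z in W ⁻¹' Set.Ioo (c j) (c (j + 1)), (W z - x j) ∂P := by
      refine setIntegral_congr_ae (hW measurableSet_Ioo) ?_
      filter_upwards [hF] with z hz hzj
      rw [hz j hj hzj]
    rw [h2, setIntegral_of_uniform hW hlaw (g := fun w => w - x j) (hc0 j hj) (hc j hj).le
      (hc1 j hj) (by fun_prop), intervalIntegral.integral_sub (by simp) (by simp), integral_id,
      intervalIntegral.integral_const, smul_eq_mul] at h1
    have h3 : (c (j + 1) - c j) * ((c j + c (j + 1)) / 2 - x j) = 0 := by linarith
    rcases mul_eq_zero.1 h3 with h | h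
    · linarith [hc j hj]
    · linarith
  have hclosed : ∀ j, (j ≤ n → c j = j * c 1 + 2 * b * (j * (j - 1))) ∧
      (j + 1 ≤ n → c (j + 1) = (j + 1) * c 1 + 2 * b * ((j + 1) * j)) := by
    intro j
    induction j with
    | zero => simp [c0]
    | succ j ih =>
      refine ⟨fun h => by rw [ih.2 h]; push_cast; ring, fun h => ?_⟩
      have h1 := ih.1 (by omega)
      have h2 := ih.2 (by omega)
      have h3 := cmid j (by omega)
      have h4 := hxmid j (by omega)
      have h5 := hxmid (j + 1) (by omega)
      have h6 : c (j + 1 + 1) = 2 * c (j + 1) - c j + 4 * b := by linarith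
      rw [h6, h1, h2]
      push_cast
      ring
  have hsum : (n : ℝ) * c 1 + 2 * b * (n * (n - 1)) = 1 := by
    rw [← (hclosed n).1 le_rfl, cn]
  have hl : 0 < c 1 := c0 ▸ hc 0 hn
  refine ⟨hn, ?_, ?_⟩
  · have : 0 < (n : ℝ) * c 1 := by positivity
    linarith
  · rw [integral_sq_sub_of_cells hW hlaw hi c0 cn hc, ← sum_cube_cells hn hsum]
    · refine Finset.sum_congr rfl fun j hj => ?_
      have hj' := Finset.mem_range.1 hj
      rw [(hclosed j).2 hj', (hclosed j).1 hj'.le]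
      ring
    · filter_upwards [hF] with z hz j hj h
      rw [hz j hj h, hxmid j hj]

lemma exists_strictMono_enumeration {K : Set ℝ} (hK : K.Finite) :
    ∃ (n : ℕ) (x : ℕ → ℝ), (∀ i j, i < j → j < n → x i < x j) ∧
      (∀ j < n, x j ∈ K) ∧ ∀ y ∈ K, ∃ j < n, y = x j := by
  set e := hK.toFinset.orderEmbOfFin rfl with he
  refine ⟨hK.toFinset.card, fun j => if h : j < hK.toFinset.card then e ⟨j, h⟩ else 0, ?_, ?_, ?_⟩
  · intro i j hij hj
    simp only [hij.trans hj, hj, dif_pos]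
    exact e.strictMono hij
  · intro j hj
    simp only [hj, dif_pos]
    exact hK.mem_toFinset.1 (Finset.orderEmbOfFin_mem _ rfl _)
  · intro y hy
    have : y ∈ Set.range e := by
      rw [he, Finset.range_orderEmbOfFin]
      simpa using hy
    obtain ⟨j, hj⟩ := this
    exact ⟨j, j.2, by simp [hj]⟩

lemma finite_of_separated {K : Set ℝ} {r : ℝ} (hr : 0 < r) (hK : K ⊆ Set.Icc 0 1)
    (hsep : ∀ x ∈ K, ∀ y ∈ K, x < y → r ≤ y - x) : K.Finite := by
  have hinj : Set.InjOn (fun x : ℝ => ⌊x / r⌋) K := by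
    intro x hx y hy hxy
    have h1 := Int.abs_sub_lt_one_of_floor_eq_floor hxy
    rw [← sub_div, abs_div, abs_of_pos hr, div_lt_one hr] at h1
    by_contra hne
    rcases lt_or_gt_of_ne hne with h | h
    · linarith [hsep x hx y hy h, neg_abs_le (x - y)]
    · linarith [hsep y hy x hx h, le_abs_self (x - y)]
  refine Set.Finite.of_finite_image ((Set.finite_Icc (0 : ℤ) ⌊1 / r⌋).subset ?_) hinj
  rintro _ ⟨x, hx, rfl⟩
  have := hK hx
  exact ⟨Int.floor_nonneg.2 (div_nonneg this.1 hr.le), Int.floor_le_floor (by gcongr; exact this.2)⟩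

/-- Classification of equilibrium losses. The spacing of actions makes the support of the law of the
action `2b`-separated; hence it is finite and all its points are atoms. -/
theorem exists_loss_eq (hb : 0 < b) (hW : Measurable W) (hXm : Measurable X)
    (hlaw : P.map W = volume.restrict (Set.Icc 0 1)) (hX01 : ∀ z, X z ∈ Set.Icc (0 : ℝ) 1)
    (hi : Integrable (fun z => (X z - W z) ^ 2) P)
    (hmean : ∀ x, ∫ z in X ⁻¹' {x}, (W z - X z) ∂P = 0)
    (hgap : ∀ y, ∀ᵐ z ∂P, 0 ≤ (X y - X z) * (X y - X z - 2 * b))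
    (hIC : ∀ y, ∀ᵐ z ∂P, (X z - W z - b) ^ 2 ≤ (X y - W z - b) ^ 2) :
    ∃ n : ℕ, 0 < n ∧ 2 * b * (n * (n - 1)) < 1 ∧
      ∫ z, (X z - W z) ^ 2 ∂P = partitionLoss b n := by
  set K := (P.map X).support with hK
  have hball : ∀ x ∈ K, ∀ r > 0, P (X ⁻¹' Metric.ball x r) ≠ 0 := by
    intro x hx r hr
    rw [← Measure.map_apply hXm Metric.isOpen_ball.measurableSet]
    exact ((Measure.mem_support_iff_forall x).1 hx _ (Metric.ball_mem_nhds x hr)).ne'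
  have hsep : ∀ x ∈ K, ∀ y ∈ K, x < y → 2 * b ≤ y - x := by
    intro x hx y hy hxy
    by_contra! hlt
    obtain ⟨δ, hδ, hδ1, hδ2⟩ : ∃ δ > 0, 2 * δ ≤ y - x ∧ 2 * δ ≤ 2 * b - (y - x) :=
      ⟨min (y - x) (2 * b - (y - x)) / 2, half_pos (lt_min (by linarith) (by linarith)),
        by linarith [min_le_left (y - x) (2 * b - (y - x))],
        by linarith [min_le_right (y - x) (2 * b - (y - x))]⟩
    obtain ⟨z', hz', -⟩ := exists_mem_of_ae (hball y hy δ hδ) (ae_of_all P fun _ => trivial)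
    obtain ⟨z, hz, hz2⟩ := exists_mem_of_ae (hball x hx δ hδ) (hgap z')
    rw [Set.mem_preimage, Metric.mem_ball, Real.dist_eq, abs_lt] at hz hz'
    have h1 : 0 < X z' - X z := by linarith
    have h2 : X z' - X z - 2 * b < 0 := by linarith
    exact absurd hz2 (not_le.2 (mul_neg_of_pos_of_neg h1 h2))
  have hK01 : K ⊆ Set.Icc 0 1 := Measure.support_subset_of_isClosed isClosed_Icc
    ((ae_map_iff hXm.aemeasurable measurableSet_Icc).2 (ae_of_all _ hX01))
  have hfin := finite_of_separated (by positivity) hK01 hsep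
  have haeK : ∀ᵐ z ∂P, X z ∈ K :=
    ae_of_ae_map hXm.aemeasurable (Measure.support_mem_ae (μ := P.map X))
  have hatom : ∀ x ∈ K, P (X ⁻¹' {x}) ≠ 0 := by
    intro x hx h0
    refine hball x hx (2 * b) (by positivity) (measure_mono_null_ae ?_ h0)
    filter_upwards [haeK] with z hz hzb
    by_contra hne
    have hne' : X z ≠ x := hne
    have hzb' : |X z - x| < 2 * b := hzb
    rw [abs_lt] at hzb'
    rcases lt_or_gt_of_ne hne' with h | h
    · linarith [hsep _ hz _ hx h]
    · linarith [hsep _ hx _ hz h]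
  obtain ⟨n, x, hx, hxK, hKx⟩ := exists_strictMono_enumeration hfin
  refine ⟨n, loss_of_enumeration hW hlaw hi hmean hx (fun j hj => hatom _ (hxK j hj)) ?_ ?_⟩
  · filter_upwards [haeK] with z hz using hKx _ hz
  · intro i hin
    obtain ⟨y, hy, -⟩ := exists_mem_of_ae (hatom _ (hxK i hin)) (ae_of_all P fun _ => trivial)
    rw [← show X y = x i from hy]
    exact hIC y

end Cells

/-! ### The number of cells and the size of the loss -/

/-- `N(b)` is the ceiling of the positive root `r` of `2 b r (r + 1) = 1`. -/
lemma maxCells_spec {b : ℝ} (hb : 0 < b) : 0 < maxCells b ∧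
    2 * b * (maxCells b * (maxCells b - 1)) < 1 ∧ 1 ≤ 2 * b * (maxCells b * (maxCells b + 1)) ∧
    ∀ n : ℕ, 2 * b * (n * (n - 1)) < 1 → n ≤ maxCells b := by
  set r : ℝ := -(1 / 2 : ℝ) + (1 / 2) * Real.sqrt (1 + 2 / b) with hr
  have hs : 1 < Real.sqrt (1 + 2 / b) := by
    rw [Real.lt_sqrt (by norm_num)]
    have : 0 < 2 / b := by positivity
    linarith
  have hr0 : 0 < r := by rw [hr]; linarith
  have hroot : 2 * b * (r * (r + 1)) = 1 := by
    have h := Real.sq_sqrt (show 0 ≤ 1 + 2 / b by positivity)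
    have : r * (r + 1) = (Real.sqrt (1 + 2 / b) ^ 2 - 1) / 4 := by rw [hr]; ring
    rw [this, h]
    field_simp
    ring
  have hN : maxCells b = ⌈r⌉₊ := rfl
  have h1 : r ≤ maxCells b := by rw [hN]; exact Nat.le_ceil r
  have h2 : (maxCells b : ℝ) < r + 1 := by rw [hN]; exact Nat.ceil_lt_add_one hr0.le
  have h3 : 0 < maxCells b := by rw [hN]; exact Nat.ceil_pos.2 hr0
  have h4 : (1 : ℝ) ≤ maxCells b := by exact_mod_cast h3
  refine ⟨h3, ?_, ?_, fun n hn => ?_⟩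
  · have : (maxCells b : ℝ) * (maxCells b - 1) < r * (r + 1) := by nlinarith
    nlinarith
  · have : r * (r + 1) ≤ (maxCells b : ℝ) * (maxCells b + 1) := by nlinarith
    nlinarith
  · by_contra! hlt
    have h5 : (maxCells b : ℝ) + 1 ≤ n := by exact_mod_cast hlt
    have : r * (r + 1) ≤ (n : ℝ) * (n - 1) := by nlinarith
    nlinarith

/-- More cells are better as long as the partition exists. -/
lemma partitionLoss_le {b : ℝ} (hb : 0 < b) {n N : ℕ} (hn : 0 < n) (hnN : n ≤ N)
    (hN : 2 * b * (N * (N - 1)) < 1) : partitionLoss b N ≤ partitionLoss b n := by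
  rcases hnN.eq_or_lt with rfl | hlt
  · exact le_rfl
  have h1 : (n : ℝ) + 1 ≤ N := by exact_mod_cast hlt
  have h2 : (0 : ℝ) < n := by exact_mod_cast hn
  have h3 : 2 * b * (n * N) < 1 := by
    have : (n : ℝ) * N ≤ N * (N - 1) := by nlinarith
    nlinarith
  have hN0 : (0 : ℝ) < N := by linarith
  have h4 : (2 * b * (n * N)) ^ 2 ≤ 1 := pow_le_one₀ (by positivity) h3.le
  have h5 : partitionLoss b n - partitionLoss b N =
      ((N : ℝ) ^ 2 - n ^ 2) * (1 - (2 * b * (n * N)) ^ 2) / (12 * n ^ 2 * N ^ 2) := by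
    unfold partitionLoss
    field_simp
    ring
  have h6 : 0 ≤ ((N : ℝ) ^ 2 - n ^ 2) * (1 - (2 * b * (n * N)) ^ 2) / (12 * n ^ 2 * N ^ 2) :=
    div_nonneg (mul_nonneg (by nlinarith) (by linarith)) (by positivity)
  linarith

/-- Every equilibrium loss is at least of order `b`: the imprecision term `1 / (12 n²)` and the
term `b² n² / 3` have geometric mean `b / 6`. -/
lemma third_le_loss (b : ℝ) {n : ℕ} (hn : 0 < n) : b / 3 ≤ b ^ 2 + partitionLoss b n := by
  have hn' : (0 : ℝ) < n := by exact_mod_cast hn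
  have : b ^ 2 + partitionLoss b n - b / 3 =
      (1 - 2 * b * n ^ 2) ^ 2 / (12 * n ^ 2) + 2 * b ^ 2 / 3 := by
    unfold partitionLoss
    field_simp
    ring
  have h2 : 0 ≤ (1 - 2 * b * (n : ℝ) ^ 2) ^ 2 / (12 * n ^ 2) + 2 * b ^ 2 / 3 := by positivity
  linarith

lemma loss_maxCells_le {b : ℝ} (hb : 0 < b) (hb1 : b ≤ 1) :
    b ^ 2 + partitionLoss b (maxCells b) ≤ 5 / 3 * b := by
  obtain ⟨h0, h1, h2, -⟩ := maxCells_spec hb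
  have h0' : (1 : ℝ) ≤ maxCells b := by exact_mod_cast h0
  generalize (maxCells b) = N at *
  have h3 : 1 ≤ 4 * b * (N : ℝ) ^ 2 := by nlinarith
  have h4 : b * (N : ℝ) ^ 2 ≤ b + 1 := by nlinarith [sq_nonneg ((N : ℝ) - 1)]
  have h5 : 1 / (12 * (N : ℝ) ^ 2) ≤ b / 3 := by
    rw [div_le_iff₀ (by positivity)]
    linarith
  have h6 : b * (b * (N : ℝ) ^ 2) ≤ b * (b + 1) := by gcongr
  unfold partitionLoss
  nlinarith

/-! ### Upper bound for equilibrium payoffs -/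

lemma map_fst_compProd (π : Kernel I I) [IsMarkovKernel π] :
    (prior ⊗ₘ π).map (fun z => (z.1 : ℝ)) = volume.restrict (Set.Icc 0 1) := by
  have h1 : (prior ⊗ₘ π).map Prod.fst = prior := Measure.fst_compProd prior π
  have h2 : prior.map ((↑) : I → ℝ) = volume.restrict (Set.Icc 0 1) :=
    unitInterval.measurePreserving_coe.map_eq
  rw [← h2]
  conv_rhs => rw [← h1]
  rw [Measure.map_map measurable_subtype_coe measurable_fst]
  rfl

/-- Every equilibrium payoff is the payoff of a partition with `n ≤ N(b)` cells. -/
lemma exists_payoff_eq {b : ℝ} (hb : 0 < b) {x : ℝ} (hx : x ∈ covertPayoffs b) :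
    ∃ n : ℕ, 0 < n ∧ n ≤ maxCells b ∧ x = -b ^ 2 - partitionLoss b n := by
  obtain ⟨π, α, bel, h, rfl⟩ := hx
  have := h.markov_info
  have := h.markov_action
  have := h.markov_belief
  have hm := measurable_posteriorMean bel
  have hi := integrable_sq_loss (prior ⊗ₘ π) measurable_fst (hm.comp measurable_snd) 0
  simp only [Function.comp_apply, sub_zero] at hi
  obtain ⟨n, hn, hnb, hloss⟩ := exists_loss_eq (P := prior ⊗ₘ π) (W := fun z => (z.1 : ℝ))
    (X := fun z => (posteriorMean bel z.2 : ℝ)) hb (by fun_prop)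
    (measurable_subtype_coe.comp (hm.comp measurable_snd)) (map_fst_compProd π)
    (fun z => (posteriorMean bel z.2).2) hi
    (fun x => h.consistent.setIntegral_sub
      (B := {s | (posteriorMean bel s : ℝ) = x})
      ((measurable_subtype_coe.comp hm) (measurableSet_singleton x)))
    (fun y => h.ae_gap y.2)
    (fun y => h.sender_optimal.ae_le hm h.receiver_optimal.ae_eq y.2)
  refine ⟨n, hn, (maxCells_spec hb).2.2.2 n hnb, ?_⟩
  rw [senderPayoff_eq_of_consistent b h.receiver_optimal h.consistent, hloss]

/-! ### Reversible information structures -/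

/-- If the prior is in detailed balance with `π`, then the posterior given a signal `s` is
`π(· ∣ s)` itself. -/
lemma bayesConsistent_of_isReversible {π : Kernel I I} [IsMarkovKernel π]
    (h : π.IsReversible prior) : BayesConsistent π π := by
  have hinv : signalLaw π = prior := h.invariant
  rw [BayesConsistent, hinv]
  refine Measure.ext_prod fun {A B} hA hB => ?_
  rw [Measure.map_apply measurable_swap (hA.prod hB), Set.preimage_swap_prod,
    Measure.compProd_apply_prod hB hA, Measure.compProd_apply_prod hA hB, h hB hA]

/-- The receiver's strategy of playing the posterior mean. -/
def bestResponse (bel : Kernel I I) : Kernel I I :=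
  Kernel.deterministic (posteriorMean bel) (measurable_posteriorMean bel)

instance (bel : Kernel I I) : IsMarkovKernel (bestResponse bel) := by
  unfold bestResponse; infer_instance

lemma receiverOptimal_bestResponse (bel : Kernel I I) [IsMarkovKernel bel] :
    ReceiverOptimal (bestResponse bel) bel :=
  receiverOptimal_of_eq_dirac fun s => Kernel.deterministic_apply _ s

/-! ### Overt persuasion -/

lemma isReversible_id : (Kernel.id : Kernel I I).IsReversible prior := by
  have e : ∀ {A B : Set I}, MeasurableSet A → MeasurableSet B →
      ∫⁻ x in A, (Kernel.id : Kernel I I) x B ∂prior = prior (B ∩ A) := by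
    intro A B hA hB
    simp only [Kernel.id_apply, Measure.dirac_apply' _ hB]
    rw [lintegral_indicator_one hB, Measure.restrict_apply hB]
  intro A B hA hB
  rw [e hA hB, e hB hA, Set.inter_comm]

lemma posteriorMean_id (s : I) : posteriorMean Kernel.id s = s := by
  apply Subtype.ext
  rw [posteriorMean, Kernel.id_apply, coe_meanAction, integral_dirac]

/-- Full revelation is optimal for a sender who commits to a public information structure. -/
lemma isGreatest_overtPayoffs (b : ℝ) : IsGreatest (overtPayoffs b) (-b ^ 2) := by
  constructor
  · have hc := bayesConsistent_of_isReversible isReversible_id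
    have hr := receiverOptimal_bestResponse Kernel.id
    refine ⟨Kernel.id, bestResponse Kernel.id, Kernel.id,
      ⟨inferInstance, inferInstance, inferInstance, hr, hc⟩, ?_⟩
    have hi := integrable_sq_loss (prior ⊗ₘ Kernel.id) measurable_fst measurable_snd 0
    simp only [sub_zero] at hi
    rw [senderPayoff_eq_of_consistent b hr hc]
    simp only [posteriorMean_id]
    rw [Measure.integral_compProd hi]
    simp only [Kernel.id_apply, integral_dirac]
    simp
  · rintro x ⟨π, α, bel, h, rfl⟩
    have := h.markov_info
    have := h.markov_action
    have := h.markov_belief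
    rw [senderPayoff_eq_of_consistent b h.receiver_optimal h.consistent]
    have : 0 ≤ ∫ z, ((posteriorMean bel z.2 : ℝ) - z.1) ^ 2 ∂(prior ⊗ₘ π) :=
      integral_nonneg fun z => sq_nonneg _
    linarith

/-! ### The partition equilibrium -/

section Partition

variable {N : ℕ} {k : ℕ → ℝ}

/-- The index of the half-open cell `[k j, k (j + 1))` containing `s`, where `s = 1` is assigned to
the last cell. -/
def cellIndex (N : ℕ) (k : ℕ → ℝ) (s : I) : ℕ := Nat.findGreatest (fun j => k j ≤ s) (N - 1)

/-- The open cell `(k j, k (j + 1))` as a set of states. -/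
def cell (k : ℕ → ℝ) (j : ℕ) : Set I := (fun s : I => (s : ℝ)) ⁻¹' Set.Ioo (k j) (k (j + 1))

lemma measurable_cellIndex (N : ℕ) (k : ℕ → ℝ) : Measurable (cellIndex N k) :=
  measurable_findGreatest fun _ _ => measurableSet_le measurable_const measurable_subtype_coe

lemma measurableSet_cell (k : ℕ → ℝ) (j : ℕ) : MeasurableSet (cell k j) :=
  measurable_subtype_coe measurableSet_Ioo

/-- The kernel that answers a state by a uniform draw from its own cell. It serves both as the
information structure and as the belief system of the partition equilibrium. -/
def cellKernel (N : ℕ) (k : ℕ → ℝ) : Kernel I I where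
  toFun s := cond (volume : Measure I) (cell k (cellIndex N k s))
  measurable' := (measurable_from_nat (f := fun j => cond (volume : Measure I) (cell k j))).comp
    (measurable_cellIndex N k)

lemma cellKernel_apply (N : ℕ) (k : ℕ → ℝ) (s : I) :
    cellKernel N k s = cond (volume : Measure I) (cell k (cellIndex N k s)) := rfl

/-- The midpoint of a cell. -/
def midpoint (k : ℕ → ℝ) (j : ℕ) : ℝ := (k j + k (j + 1)) / 2

lemma cellIndex_lt (hN : 0 < N) (s : I) : cellIndex N k s < N := by
  have : cellIndex N k s ≤ N - 1 := Nat.findGreatest_le _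
  omega

lemma cutoff_cellIndex_le (h0 : k 0 = 0) (s : I) : k (cellIndex N k s) ≤ s :=
  Nat.findGreatest_spec (P := fun j => k j ≤ s) (Nat.zero_le _) (by rw [h0]; exact s.2.1)

lemma le_cutoff_cellIndex_succ (hN : 0 < N) (h1 : k N = 1) (s : I) :
    (s : ℝ) ≤ k (cellIndex N k s + 1) := by
  rcases Nat.lt_or_ge (cellIndex N k s + 1) N with h | h
  · exact (not_le.1 (Nat.findGreatest_is_greatest (P := fun j => k j ≤ s)
      (Nat.lt_succ_self (cellIndex N k s)) (by omega))).le
  · rw [show cellIndex N k s + 1 = N by have := cellIndex_lt (k := k) hN s; omega, h1]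
    exact s.2.2

lemma cellIndex_eq_of_mem (h0 : k 0 = 0) (h1 : k N = 1) (hk : ∀ j < N, k j < k (j + 1)) {j : ℕ}
    (hj : j < N) {s : I} (hs : s ∈ cell k j) : cellIndex N k s = j := by
  have hN : 0 < N := by omega
  rcases lt_trichotomy (cellIndex N k s) j with h | h | h
  · linarith [chain_le hk (show cellIndex N k s + 1 ≤ j from h) hj.le, hs.1,
      le_cutoff_cellIndex_succ hN h1 s]
  · exact h
  · linarith [chain_le hk (show j + 1 ≤ cellIndex N k s from h) (cellIndex_lt hN s).le, hs.2,
      cutoff_cellIndex_le (N := N) h0 s]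

lemma ae_mem_cell (hN : 0 < N) (h0 : k 0 = 0) (h1 : k N = 1) :
    ∀ᵐ s ∂prior, s ∈ cell k (cellIndex N k s) := by
  have h := ae_ne_of_uniform measurable_subtype_coe unitInterval.measurePreserving_coe.map_eq k
  filter_upwards [h] with s hs
  exact ⟨lt_of_le_of_ne (cutoff_cellIndex_le h0 s) (hs _).symm,
    lt_of_le_of_ne (le_cutoff_cellIndex_succ hN h1 s) (hs _)⟩

lemma setIntegral_cell (h0 : k 0 = 0) (h1 : k N = 1) (hk : ∀ j < N, k j < k (j + 1)) {j : ℕ}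
    (hj : j < N) {g : ℝ → ℝ} (hg : Continuous g) :
    ∫ s in cell k j, g s = ∫ w in (k j)..(k (j + 1)), g w :=
  setIntegral_of_uniform measurable_subtype_coe unitInterval.measurePreserving_coe.map_eq
    (h0 ▸ chain_le hk (Nat.zero_le _) hj.le) (hk j hj).le (h1 ▸ chain_le hk hj le_rfl) hg

lemma measureReal_cell (h0 : k 0 = 0) (h1 : k N = 1) (hk : ∀ j < N, k j < k (j + 1)) {j : ℕ}
    (hj : j < N) : (volume : Measure I).real (cell k j) = k (j + 1) - k j := by
  have := setIntegral_cell h0 h1 hk hj (g := fun _ => 1) continuous_const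
  simpa using this

lemma volume_cell_ne_zero (h0 : k 0 = 0) (h1 : k N = 1) (hk : ∀ j < N, k j < k (j + 1)) {j : ℕ}
    (hj : j < N) : (volume : Measure I) (cell k j) ≠ 0 := by
  intro h
  have h2 := measureReal_cell h0 h1 hk hj
  rw [measureReal_def, h, ENNReal.toReal_zero] at h2
  linarith [hk j hj]

lemma isMarkovKernel_cellKernel (hN : 0 < N) (h0 : k 0 = 0) (h1 : k N = 1)
    (hk : ∀ j < N, k j < k (j + 1)) : IsMarkovKernel (cellKernel N k) :=
  ⟨fun s => cond_isProbabilityMeasure (volume_cell_ne_zero h0 h1 hk (cellIndex_lt hN s))⟩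

lemma posteriorMean_cellKernel (hN : 0 < N) (h0 : k 0 = 0) (h1 : k N = 1)
    (hk : ∀ j < N, k j < k (j + 1)) (s : I) :
    (posteriorMean (cellKernel N k) s : ℝ) = midpoint k (cellIndex N k s) := by
  have := isMarkovKernel_cellKernel hN h0 h1 hk
  have hj := cellIndex_lt (k := k) hN s
  rw [posteriorMean, coe_meanAction, cellKernel_apply, ProbabilityTheory.cond, integral_smul_measure,
    setIntegral_cell h0 h1 hk hj (g := fun w => w) continuous_id, integral_id, ENNReal.toReal_inv,
    ← measureReal_def, measureReal_cell h0 h1 hk hj, midpoint, smul_eq_mul]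
  have := hk _ hj
  have : k (cellIndex N k s + 1) - k (cellIndex N k s) ≠ 0 := by linarith
  field_simp
  ring

lemma isReversible_cellKernel (hN : 0 < N) (h0 : k 0 = 0) (h1 : k N = 1)
    (hk : ∀ j < N, k j < k (j + 1)) : (cellKernel N k).IsReversible prior := by
  have e : ∀ {A B : Set I}, MeasurableSet A → MeasurableSet B →
      ∫⁻ s in A, cellKernel N k s B ∂prior = ∑ j ∈ Finset.range N,
        (volume (cell k j))⁻¹ * volume (cell k j ∩ B) * volume (cell k j ∩ A) := by
    intro A B hA hB
    have h : ∀ᵐ s ∂(prior.restrict A), cellKernel N k s B = ∑ j ∈ Finset.range N,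
        (cell k j).indicator (fun _ => (volume (cell k j))⁻¹ * volume (cell k j ∩ B)) s := by
      refine ae_restrict_of_ae ?_
      filter_upwards [ae_mem_cell hN h0 h1] with s hs
      rw [Finset.sum_eq_single (cellIndex N k s), Set.indicator_of_mem hs, cellKernel_apply,
        cond_apply (measurableSet_cell _ _)]
      · intro j hj hne
        refine Set.indicator_of_notMem (fun hs' => hne ?_) _
        exact (cellIndex_eq_of_mem h0 h1 hk (Finset.mem_range.1 hj) hs').symm
      · intro h
        exact absurd (Finset.mem_range.2 (cellIndex_lt hN s)) h
    rw [lintegral_congr_ae h, lintegral_finsetSum _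
      (fun j _ => measurable_const.indicator (measurableSet_cell k j))]
    refine Finset.sum_congr rfl fun j _ => ?_
    rw [lintegral_indicator_const (measurableSet_cell k j),
      Measure.restrict_apply (measurableSet_cell k j)]
    rfl
  intro A B hA hB
  rw [e hA hB, e hB hA]
  exact Finset.sum_congr rfl fun j _ => mul_right_comm _ _ _

lemma ae_cellIndex_eq (hN : 0 < N) (h0 : k 0 = 0) (h1 : k N = 1) (hk : ∀ j < N, k j < k (j + 1)) :
    ∀ᵐ z ∂(prior ⊗ₘ cellKernel N k), cellIndex N k z.2 = cellIndex N k z.1 := by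
  have := isMarkovKernel_cellKernel hN h0 h1 hk
  have hm := measurable_cellIndex N k
  refine Measure.ae_compProd_of_ae_ae (measurableSet_eq_fun (hm.comp measurable_snd)
    (hm.comp measurable_fst)) (ae_of_all _ fun ω => ?_)
  rw [cellKernel_apply]
  filter_upwards [ae_cond_mem (measurableSet_cell k _)] with s hs
  exact cellIndex_eq_of_mem h0 h1 hk (cellIndex_lt hN ω) hs

/-- If each cutoff type is indifferent between the two adjacent actions, every type prefers the
action of its own cell. -/
lemma sq_midpoint_le {b : ℝ} (hN : 0 < N) (h0 : k 0 = 0) (h1 : k N = 1)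
    (hk : ∀ j < N, k j < k (j + 1))
    (hind : ∀ j, j + 1 < N → midpoint k j + midpoint k (j + 1) = 2 * (k (j + 1) + b)) (ω : I)
    {i : ℕ} (hi : i < N) :
    (midpoint k (cellIndex N k ω) - ω - b) ^ 2 ≤ (midpoint k i - ω - b) ^ 2 := by
  have hmono : ∀ i j, i ≤ j → j < N → midpoint k i ≤ midpoint k j := by
    intro i j hij hj
    have h2 := chain_le hk hij hj.le
    have h3 := chain_le hk (Nat.succ_le_succ hij) hj
    simp only [midpoint, Nat.succ_eq_add_one] at *
    linarith
  have hj := cellIndex_lt (k := k) hN ω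
  have hlo := cutoff_cellIndex_le (N := N) h0 ω
  have hhi := le_cutoff_cellIndex_succ hN h1 ω
  generalize cellIndex N k ω = j at *
  rcases lt_trichotomy i j with h | rfl | h
  · obtain ⟨j, rfl⟩ : ∃ j', j = j' + 1 := ⟨j - 1, by omega⟩
    have h2 := hind j hj
    have h3 := hmono i j (by omega) (by omega)
    have h4 := hmono i (j + 1) h.le hj
    nlinarith
  · exact le_rfl
  · have h2 := hind j (by omega)
    have h3 := hmono (j + 1) i h hi
    have h4 := hmono j i h.le hi
    nlinarith

/-- Signals drawn uniformly from the cells of an indifferent partition, together with the induced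
beliefs and mean actions, form an equilibrium. -/
lemma isPBE_cellKernel {b : ℝ} (hN : 0 < N) (h0 : k 0 = 0) (h1 : k N = 1)
    (hk : ∀ j < N, k j < k (j + 1))
    (hind : ∀ j, j + 1 < N → midpoint k j + midpoint k (j + 1) = 2 * (k (j + 1) + b)) :
    IsPBE b (cellKernel N k) (bestResponse (cellKernel N k)) (cellKernel N k) := by
  have hM := isMarkovKernel_cellKernel hN h0 h1 hk
  have hr := receiverOptimal_bestResponse (cellKernel N k)
  have hm := measurable_posteriorMean (cellKernel N k)
  refine ⟨hM, inferInstance, hM, fun μ hμ => ?_, hr,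
    bayesConsistent_of_isReversible (isReversible_cellKernel hN h0 h1 hk)⟩
  rw [senderPayoff_eq b μ _ hm hr.ae_eq, senderPayoff_eq b _ _ hm hr.ae_eq, neg_le_neg_iff]
  have i1 (η : Kernel I I) [IsMarkovKernel η] :=
    integrable_sq_loss (prior ⊗ₘ η) measurable_fst (hm.comp measurable_snd) b
  have i2 (η : Kernel I I) [IsMarkovKernel η] :=
    integrable_sq_loss (prior ⊗ₘ η) measurable_fst (hm.comp measurable_fst) b
  -- the loss from the action of a type's own cell does not depend on the information structure
  have key (η : Kernel I I) [IsMarkovKernel η] :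
      ∫ z, ((posteriorMean (cellKernel N k) z.1 : ℝ) - z.1 - b) ^ 2 ∂(prior ⊗ₘ η) =
        ∫ ω, ((posteriorMean (cellKernel N k) ω : ℝ) - ω - b) ^ 2 ∂prior := by
    rw [Measure.integral_compProd (by exact i2 η)]
    simp
  calc ∫ z, ((posteriorMean (cellKernel N k) z.2 : ℝ) - z.1 - b) ^ 2 ∂(prior ⊗ₘ cellKernel N k)
      = ∫ z, ((posteriorMean (cellKernel N k) z.1 : ℝ) - z.1 - b) ^ 2
          ∂(prior ⊗ₘ cellKernel N k) := by
        refine integral_congr_ae ?_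
        filter_upwards [ae_cellIndex_eq hN h0 h1 hk] with z hz
        rw [posteriorMean_cellKernel hN h0 h1 hk, posteriorMean_cellKernel hN h0 h1 hk, hz]
    _ = ∫ z, ((posteriorMean (cellKernel N k) z.1 : ℝ) - z.1 - b) ^ 2 ∂(prior ⊗ₘ μ) := by
        rw [key, key]
    _ ≤ ∫ z, ((posteriorMean (cellKernel N k) z.2 : ℝ) - z.1 - b) ^ 2 ∂(prior ⊗ₘ μ) := by
        refine integral_mono (i2 μ) (i1 μ) fun z => ?_
        simp only [posteriorMean_cellKernel hN h0 h1 hk]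
        exact sq_midpoint_le hN h0 h1 hk hind z.1 (cellIndex_lt hN z.2)

lemma senderPayoff_cellKernel (b : ℝ) (hN : 0 < N) (h0 : k 0 = 0) (h1 : k N = 1)
    (hk : ∀ j < N, k j < k (j + 1)) :
    senderPayoff b (cellKernel N k) (bestResponse (cellKernel N k)) =
      -b ^ 2 - ∑ j ∈ Finset.range N, (k (j + 1) - k j) ^ 3 / 12 := by
  have hM := isMarkovKernel_cellKernel hN h0 h1 hk
  have hm := measurable_posteriorMean (cellKernel N k)
  have hi := integrable_sq_loss (prior ⊗ₘ cellKernel N k) measurable_fst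
    (hm.comp measurable_snd) 0
  simp only [Function.comp_apply, sub_zero] at hi
  rw [senderPayoff_eq_of_consistent b (receiverOptimal_bestResponse _)
    (bayesConsistent_of_isReversible (isReversible_cellKernel hN h0 h1 hk)),
    integral_sq_sub_of_cells (W := fun z : I × I => (z.1 : ℝ)) (by fun_prop)
      (map_fst_compProd _) hi h0 h1 hk]
  filter_upwards [ae_cellIndex_eq hN h0 h1 hk] with z hz j hj hzj
  rw [posteriorMean_cellKernel hN h0 h1 hk, hz, cellIndex_eq_of_mem h0 h1 hk hj hzj, midpoint]

lemma isPartitionSignaling_cellKernel (h0 : k 0 = 0) (h1 : k N = 1)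
    (hk : ∀ j < N, k j < k (j + 1)) : IsPartitionSignaling N k (cellKernel N k) := by
  refine ⟨h0, h1, hk, fun j hj ω hω => ?_⟩
  rw [cellKernel_apply, cellIndex_eq_of_mem h0 h1 hk hj hω]
  rfl

end Partition

/-- There is an equilibrium with the maximal number of cells. The cells have lengths `l + 4 b j`,
where `l > 0` is chosen so that the lengths add up to `1`. -/
lemma exists_partition_PBE {b : ℝ} (hb : 0 < b) :
    ∃ (k : ℕ → ℝ) (π α bel : Kernel I I), IsPartitionSignaling (maxCells b) k π ∧
      IsPBE b π α bel ∧ senderPayoff b π α = -b ^ 2 - partitionLoss b (maxCells b) := by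
  obtain ⟨hN, hlt, -, -⟩ := maxCells_spec hb
  generalize maxCells b = N at *
  have hN' : (0 : ℝ) < N := by exact_mod_cast hN
  set l : ℝ := (1 - 2 * b * (N * (N - 1))) / N with hl
  have hl0 : 0 < l := div_pos (by linarith) hN'
  have hsum : N * l + 2 * b * (N * (N - 1)) = 1 := by
    rw [hl]
    field_simp
    ring
  set k : ℕ → ℝ := fun j => j * l + 2 * b * (j * (j - 1)) with hkdef
  have hlen : ∀ j, k (j + 1) - k j = l + 4 * b * j := by
    intro j
    simp only [hkdef]
    push_cast
    ring
  have h0 : k 0 = 0 := by simp [hkdef]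
  have hk : ∀ j < N, k j < k (j + 1) := by
    intro j _
    have : 0 < l + 4 * b * j := by positivity
    linarith [hlen j]
  have hind : ∀ j, j + 1 < N → midpoint k j + midpoint k (j + 1) = 2 * (k (j + 1) + b) := by
    intro j _
    have h2 := hlen j
    have h3 := hlen (j + 1)
    push_cast at h3
    simp only [midpoint]
    linarith
  refine ⟨k, _, _, _, isPartitionSignaling_cellKernel h0 hsum hk,
    isPBE_cellKernel hN h0 hsum hk hind, ?_⟩
  rw [senderPayoff_cellKernel b hN h0 hsum hk, ← sum_cube_cells hN hsum]
  simp only [hlen]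

/-! ### Values and the price of transparency -/

lemma overtValue_eq (b : ℝ) : overtValue b = -b ^ 2 := (isGreatest_overtPayoffs b).csSup_eq

lemma isGreatest_covertPayoffs {b : ℝ} (hb : 0 < b) :
    IsGreatest (covertPayoffs b) (-b ^ 2 - partitionLoss b (maxCells b)) := by
  constructor
  · obtain ⟨k, π, α, bel, -, h, hp⟩ := exists_partition_PBE hb
    exact ⟨π, α, bel, h, hp.symm⟩
  · intro x hx
    obtain ⟨n, hn, hnN, rfl⟩ := exists_payoff_eq hb hx
    linarith [partitionLoss_le hb hn hnN (maxCells_spec hb).2.1]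

lemma covertValue_eq {b : ℝ} (hb : 0 < b) :
    covertValue b = -b ^ 2 - partitionLoss b (maxCells b) := (isGreatest_covertPayoffs hb).csSup_eq

lemma covertPayoffs_le {b : ℝ} (hb : 0 < b) {x : ℝ} (hx : x ∈ covertPayoffs b) : x ≤ -(b / 3) := by
  obtain ⟨n, hn, -, rfl⟩ := exists_payoff_eq hb hx
  linarith [third_le_loss b hn]

lemma priceOfTransparency_bounds {b : ℝ} (hb : 0 < b) {x : ℝ} (hx : x ∈ covertPayoffs b) :
    0 < priceOfTransparency b x ∧ priceOfTransparency b x ≤ 3 * b := by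
  have h := covertPayoffs_le hb hx
  have h2 : 0 < -x := by linarith
  rw [priceOfTransparency, overtValue_eq, ← neg_div_neg_eq, neg_neg]
  refine ⟨by positivity, ?_⟩
  rw [div_le_iff₀ h2]
  nlinarith

end QCG

end

theorem theorem4 :
    -- the persuasion value is attained and equals `-b²`
    (∀ b : ℝ, 0 < b →
      IsGreatest (QCG.overtPayoffs b) (QCG.overtValue b) ∧ QCG.overtValue b = -b ^ 2) ∧
    -- the best equilibrium payoff of covert signaling is attained, by an `N(b)`-cell partition
    -- equilibrium
    (∀ b : ℝ, 0 < b →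
      IsGreatest (QCG.covertPayoffs b) (QCG.covertValue b) ∧
      ∃ (k : ℕ → ℝ) (π α bel : ProbabilityTheory.Kernel unitInterval unitInterval),
        QCG.IsPartitionSignaling (QCG.maxCells b) k π ∧ QCG.IsPBE b π α bel ∧
        QCG.senderPayoff b π α = QCG.covertValue b) ∧
    -- the best covert payoff is exactly of first order in `b`
    (fun b : ℝ => QCG.covertValue b) =Θ[𝓝[>] (0 : ℝ)] (fun b : ℝ => b) ∧
    -- the price of transparency tends to `0` for the best equilibrium ...
    Tendsto (fun b : ℝ => QCG.priceOfTransparency b (QCG.covertValue b)) (𝓝[>] (0 : ℝ)) (𝓝 0) ∧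
    -- ... and uniformly over all equilibria
    (∀ ε : ℝ, 0 < ε → ∃ δ : ℝ, 0 < δ ∧ ∀ b : ℝ, 0 < b → b < δ →
      ∀ x ∈ QCG.covertPayoffs b, x < 0 ∧
        0 < QCG.priceOfTransparency b x ∧ QCG.priceOfTransparency b x < ε) := by
  have hmem {b : ℝ} (hb : 0 < b) : QCG.covertValue b ∈ QCG.covertPayoffs b :=
    QCG.covertValue_eq hb ▸ (QCG.isGreatest_covertPayoffs hb).1
  have hpos : ∀ᶠ b : ℝ in 𝓝[>] 0, 0 < b := eventually_mem_nhdsWithin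
  refine ⟨fun b _ => ?_, fun b hb => ?_, ⟨?_, ?_⟩, ?_, fun ε hε => ?_⟩
  · rw [QCG.overtValue_eq]
    exact ⟨QCG.isGreatest_overtPayoffs b, rfl⟩
  · rw [QCG.covertValue_eq hb]
    exact ⟨QCG.isGreatest_covertPayoffs hb, QCG.exists_partition_PBE hb⟩
  · have hone : ∀ᶠ b : ℝ in 𝓝[>] 0, b < 1 :=
      eventually_nhdsWithin_of_eventually_nhds (gt_mem_nhds one_pos)
    refine IsBigO.of_bound (5 / 3) ?_
    filter_upwards [hpos, hone] with b hb hb1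
    have h1 := QCG.covertPayoffs_le hb (hmem hb)
    rw [Real.norm_of_nonpos (by linarith), Real.norm_of_nonneg hb.le, QCG.covertValue_eq hb]
    linarith [QCG.loss_maxCells_le hb hb1.le]
  · refine IsBigO.of_bound 3 ?_
    filter_upwards [hpos] with b hb
    have h1 := QCG.covertPayoffs_le hb (hmem hb)
    rw [Real.norm_of_nonpos (show QCG.covertValue b ≤ 0 by linarith), Real.norm_of_nonneg hb.le]
    linarith
  · refine squeeze_zero' (g := fun b => 3 * b) ?_ ?_ ?_
    · filter_upwards [hpos] with b hb using (QCG.priceOfTransparency_bounds hb (hmem hb)).1.le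
    · filter_upwards [hpos] with b hb using (QCG.priceOfTransparency_bounds hb (hmem hb)).2
    · have : Tendsto (fun b : ℝ => 3 * b) (𝓝 0) (𝓝 (3 * 0)) := tendsto_id.const_mul 3
      rw [mul_zero] at this
      exact this.mono_left nhdsWithin_le_nhds
  · refine ⟨ε / 3, by positivity, fun b hb hbδ x hx => ?_⟩
    obtain ⟨h1, h2⟩ := QCG.priceOfTransparency_bounds hb hx
    exact ⟨by linarith [QCG.covertPayoffs_le hb hx], h1, by linarith⟩
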